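/- Let $k$ be a number field with ring of integers $\mathfrak o$ and Dedekind zeta function $\zeta_k(s)$, let $d\ge 0$ be an integer, and put $C=\binom{d+1}{2}$. For indeterminates $X_1,\dots,X_d$ define matrices $c_d(X_1,\dots,X_d)$ with $C$ rows and $d$ columns recursively: $c_0$ is the empty matrix and, for $d\ge1$, $$c_d(X_1,\dots,X_d)=\begin{bmatrix} X_1 1_d\\ \begin{array}{c|c} 0_{\binom d2\times 1} & c_{d-1}(X_2,\dots,X_d)\end{array}\end{bmatrix},$$ where $1_d$ is the $d\times d$ identity matrix. Let $\gamma_d\colon \mathbf Z^d\to \mathrm{Mat}_{C\times d}(\mathbf Z)$ be given by $a\mapsto c_d(a)$, with matrices acting on row vectors from the right, and let $\gamma_d^{\mathfrak o}$ be its base change to $\mathfrak o$. Let $\mathsf H$ be the group functor attached to $\gamma_d^{\mathfrak o}$: for a commutative $\mathfrak o$-algebra $A$, $\mathsf H(A)=A^d\ltimes(A^{C}\oplus A^d)$ is the semidirect product for the action $(x,y).a=(x,\;x\,c_d(a)+y)$ of the additive group $A^d\ni a$ on $A^{C}\oplus A^d\ni(x,y)$. For every ideal $I$ of $\mathfrak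 o$ with $\mathfrak o/I$ finite, the group $\mathsf H(\mathfrak o/I)$ is finite; let $\mathrm k(\mathsf H(\mathfrak o/I))$ be its number of conjugacy classes, and define the conjugacy class zeta function $$\zeta^{\mathrm{cc}}_{\mathsf H}(s)=\sum_{I}\mathrm k(\mathsf H(\mathfrak o/I))\,|\mathfrak o/I|^{-s},$$ the sum extending over all ideals $I$ of $\mathfrak o$ with $|\mathfrak o/I|<\infty$. Then $$\zeta^{\mathrm{cc}}_{\mathsf H}(s)=\frac{\zeta_k(s-C-d)\,\zeta_k(s-C-d+1)}{\zeta_k(s-C+1)},$$ both as an identity of formal Dirichlet series (in which ring the denominator is invertible) and as an identity of complex numbers for every $s\in\mathbf C$ with $\mathrm{Re}(s)>C+d+1$; for such $s$ the series on the left converges absolutely and the denominator on the right is non-zero. -/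

import Mathlib

open CategoryTheory TensorProduct

namespace AskZeta

universe u

section ModuleRepresentations

variable {R : Type*} [CommRing R] {M V W : Type*}
  [AddCommGroup M] [AddCommGroup V] [AddCommGroup W] [Module R M] [Module R V] [Module R W]

/-- Change of scalars of a module representation `θ : M → Hom_R(V, W)` along `R → A`: the module
representation `A ⊗ M → Hom_A(A ⊗ V, A ⊗ W)` with `(s ⊗ a) ↦ (t ⊗ x ↦ s t ⊗ x(aθ))`. -/
noncomputable def changeScalars (θ : M →ₗ[R] V →ₗ[R] W) (A : Type*) [CommRing A] [Algebra R A] :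
    A ⊗[R] M →ₗ[A] A ⊗[R] V →ₗ[A] A ⊗[R] W :=
  LinearMap.liftBaseChange A (LinearMap.baseChangeHom R A V W ∘ₗ θ)

theorem changeScalars_tmul (θ : M →ₗ[R] V →ₗ[R] W) (A : Type*) [CommRing A] [Algebra R A]
    (s t : A) (a : M) (x : V) :
    changeScalars θ A (s ⊗ₜ a) (t ⊗ₜ x) = (s * t) ⊗ₜ θ a x := by
  simp [changeScalars, LinearMap.baseChangeHom, TensorProduct.smul_tmul']

theorem changeScalars_natural (θ : M →ₗ[R] V →ₗ[R] W) {A B : Type*} [CommRing A] [Algebra R A]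
    [CommRing B] [Algebra R B] (f : A →ₐ[R] B) (a : A ⊗[R] M) (x : A ⊗[R] V) :
    f.toLinearMap.rTensor W (changeScalars θ A a x) =
      changeScalars θ B (f.toLinearMap.rTensor M a) (f.toLinearMap.rTensor V x) := by
  induction a with
  | zero => simp
  | add a b ha hb => simp only [map_add, LinearMap.add_apply, ha, hb]
  | tmul s a =>
    induction x with
    | zero => simp
    | add x y hx hy => simp only [map_add, hx, hy]
    | tmul t x => simp [changeScalars_tmul]

/-- The underlying set of the semidirect product `M ⋉ (V ⊕ W)` attached to a module
representation `θ : M → Hom_R(V, W)`. -/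
@[ext]
structure SemidirectGroup (θ : M →ₗ[R] V →ₗ[R] W) where
  /-- the component in the acting group `M` -/
  act : M
  /-- the component in the normal subgroup `V ⊕ W` -/
  vec : V × W

namespace SemidirectGroup

variable (θ : M →ₗ[R] V →ₗ[R] W)

/-- The right action of the additive group `M` on `V ⊕ W`: `(x, y).a = (x, x(aθ) + y)`. -/
def rightAct (p : V × W) (a : M) : V × W := (p.1, θ a p.1 + p.2)

/-- The group law of `M ⋉ (V ⊕ W)` for a right action: `(a, p) (b, q) = (a + b, p.b + q)`. -/
instance : Mul (SemidirectGroup θ) := ⟨fun g h ↦ ⟨g.act + h.act, rightAct θ g.vec h.act + h.vec⟩⟩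

instance : One (SemidirectGroup θ) := ⟨⟨0, 0⟩⟩

instance : Inv (SemidirectGroup θ) := ⟨fun g ↦ ⟨-g.act, -rightAct θ g.vec (-g.act)⟩⟩

theorem mul_def (g h : SemidirectGroup θ) :
    g * h = ⟨g.act + h.act, rightAct θ g.vec h.act + h.vec⟩ := rfl

theorem one_def : (1 : SemidirectGroup θ) = ⟨0, 0⟩ := rfl

theorem inv_def (g : SemidirectGroup θ) : g⁻¹ = ⟨-g.act, -rightAct θ g.vec (-g.act)⟩ := rfl

instance : Group (SemidirectGroup θ) :=
  Group.ofLeftAxioms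
    (by
      intro a b c
      ext <;> simp [mul_def, rightAct] <;> abel)
    (by
      intro a
      ext <;> simp [mul_def, one_def, rightAct])
    (by
      intro a
      ext <;> simp [mul_def, one_def, inv_def, rightAct])

end SemidirectGroup

end ModuleRepresentations

section GroupFunctor

variable {R : Type u} [CommRing R] {M V W : Type u}
  [AddCommGroup M] [AddCommGroup V] [AddCommGroup W] [Module R M] [Module R V] [Module R W]

/-- The group functor `H_θ` on commutative `R`-algebras, `H_θ(A) = M_A ⋉ (V_A ⊕ W_A)`. -/
noncomputable def groupFunctor (θ : M →ₗ[R] V →ₗ[R] W) : CommAlgCat.{u} R ⥤ GrpCat.{u} where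
  obj A := GrpCat.of (SemidirectGroup (changeScalars θ A))
  map {A B} f := GrpCat.ofHom (MonoidHom.mk'
    (fun g ↦ (⟨f.hom.toLinearMap.rTensor M g.act,
      (f.hom.toLinearMap.rTensor V g.vec.1, f.hom.toLinearMap.rTensor W g.vec.2)⟩ :
      SemidirectGroup (changeScalars θ B)))
    (by
      intro g h
      ext <;> simp [SemidirectGroup.mul_def, SemidirectGroup.rightAct, changeScalars_natural]))
  map_id A := by
    ext g
    · exact LinearMap.congr_fun (LinearMap.rTensor_id M A) g.act
    · exact LinearMap.congr_fun (LinearMap.rTensor_id V A) g.vec.1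
    · exact LinearMap.congr_fun (LinearMap.rTensor_id W A) g.vec.2
  map_comp {A B C} f h := by
    ext g
    · exact LinearMap.congr_fun
        (LinearMap.rTensor_comp M h.hom.toLinearMap f.hom.toLinearMap) g.act
    · exact LinearMap.congr_fun
        (LinearMap.rTensor_comp V h.hom.toLinearMap f.hom.toLinearMap) g.vec.1
    · exact LinearMap.congr_fun
        (LinearMap.rTensor_comp W h.hom.toLinearMap f.hom.toLinearMap) g.vec.2

end GroupFunctor

section ZetaFunctions

/-- The class number of a finite group: its number of conjugacy classes. -/
noncomputable def classNumber (G : Type*) [Group G] : ℕ := Nat.card (ConjClasses G)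

variable {R : Type u} [CommRing R]

/-- The class number of `G(R/I)` for a group functor `G` over `R` and an ideal `I` of `R`. -/
noncomputable def quotientClassNumber (G : CommAlgCat.{u} R ⥤ GrpCat.{u}) (I : Ideal R) : ℕ :=
  classNumber (G.obj (CommAlgCat.of R (R ⧸ I)))

/-- The conjugacy class zeta function of a group functor `G` over `R` as a formal Dirichlet
series, i.e. as an element of the ring of arithmetic functions under Dirichlet convolution: the
coefficient of `n ^ (-s)` is the sum of the class numbers of `G(R/I)` over all ideals `I` of `R`
with `|R/I| = n`. -/
noncomputable def ccZetaFormal (G : CommAlgCat.{u} R ⥤ GrpCat.{u}) : ArithmeticFunction ℚ where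
  toFun n := if n = 0 then 0 else
    ∑ᶠ I : {I : Ideal R // Nat.card (R ⧸ I) = n}, (quotientClassNumber G I.1 : ℚ)
  map_zero' := if_pos rfl

/-- The summand `k(G(R/I)) |R/I| ^ (-s)`, for an ideal `I` of finite index, of the conjugacy class
zeta function of a group functor `G` at a complex number `s`. -/
noncomputable def ccZetaTerm (G : CommAlgCat.{u} R ⥤ GrpCat.{u}) (s : ℂ)
    (I : {I : Ideal R // Finite (R ⧸ I)}) : ℂ :=
  (quotientClassNumber G I.1 : ℂ) * (Nat.card (R ⧸ I.1) : ℂ) ^ (-s)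

/-- The shifted Dedekind zeta function `ζ_k(s - c)`, for an integer `c`, as a formal Dirichlet
series: the coefficient of `n ^ (-s)` is `n ^ c` times the number of ideals of norm `n`. -/
noncomputable def dedekindZetaFormal (k : Type*) [Field k] [NumberField k] (c : ℤ) :
    ArithmeticFunction ℚ where
  toFun n := if n = 0 then 0 else
    (Nat.card {I : Ideal (NumberField.RingOfIntegers k) // Ideal.absNorm I = n} : ℚ) * (n : ℚ) ^ c
  map_zero' := if_pos rfl

end ZetaFunctions

section Gamma

theorem rows_succ (d : ℕ) : (d + 1) + (d + 1).choose 2 = (d + 1 + 1).choose 2 := by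
  rw [Nat.choose_succ_succ' (d + 1) 1, Nat.choose_one_right]

/-- The matrix `c_d(X_1, …, X_d)` with `d (d + 1) / 2` rows and `d` columns: `c_0` is empty, and
`c_{d+1}(X_1, …, X_{d+1})` is obtained by stacking `X_1` times the identity matrix of size `d + 1`
on top of `[ 0 | c_d(X_2, …, X_{d+1}) ]`, where `0` is a single zero column. -/
def cMatrix {S : Type*} [CommRing S] :
    (d : ℕ) → (Fin d → S) → Matrix (Fin ((d + 1).choose 2)) (Fin d) S
  | 0, _ => 0
  | d + 1, X =>
    Matrix.reindex (finSumFinEquiv.trans (finCongr (rows_succ d))) (Equiv.refl (Fin (d + 1)))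
      (Matrix.fromRows (Matrix.scalar (Fin (d + 1)) (X 0))
        (Matrix.of fun i ↦ Fin.cons 0 (cMatrix d (fun j ↦ X j.succ) i)))

theorem cMatrix_add {S : Type*} [CommRing S] (d : ℕ) (X Y : Fin d → S) :
    cMatrix d (X + Y) = cMatrix d X + cMatrix d Y := by
  induction d with
  | zero => simp [cMatrix]
  | succ d ih =>
    have h : cMatrix d (fun j ↦ (X + Y) j.succ) =
        cMatrix d (fun j ↦ X j.succ) + cMatrix d (fun j ↦ Y j.succ) := ih _ _
    ext i j
    obtain ⟨i, rfl⟩ := (finSumFinEquiv.trans (finCongr (rows_succ d))).surjective i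
    rcases i with i | i
    · simp [cMatrix, Matrix.diagonal_apply]
      split_ifs <;> simp
    · refine Fin.cases ?_ (fun j ↦ ?_) j <;> simp only [cMatrix, h] <;> simp

theorem cMatrix_smul {S : Type*} [CommRing S] (d : ℕ) (s : S) (X : Fin d → S) :
    cMatrix d (s • X) = s • cMatrix d X := by
  induction d with
  | zero => simp [cMatrix]
  | succ d ih =>
    have h : cMatrix d (fun j ↦ (s • X) j.succ) = s • cMatrix d (fun j ↦ X j.succ) := ih _
    ext i j
    obtain ⟨i, rfl⟩ := (finSumFinEquiv.trans (finCongr (rows_succ d))).surjective i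
    rcases i with i | i
    · simp [cMatrix, Matrix.diagonal_apply]
    · refine Fin.cases ?_ (fun j ↦ ?_) j <;> simp only [cMatrix, h] <;> simp

/-- The module representation `γ_d` of the free abelian group of rank `d` by `ℤ`-matrices with
`d (d + 1) / 2` rows and `d` columns, `a ↦ c_d(a)`; matrices act by right multiplication on row
vectors. -/
def gammaRep (d : ℕ) :
    (Fin d → ℤ) →ₗ[ℤ] (Fin ((d + 1).choose 2) → ℤ) →ₗ[ℤ] (Fin d → ℤ) :=
  LinearMap.mk₂ ℤ (fun a x ↦ Matrix.vecMul x (cMatrix d a))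
    (fun a b x ↦ by rw [cMatrix_add, Matrix.vecMul_add])
    (fun s a x ↦ by rw [cMatrix_smul, Matrix.vecMul_smul])
    (fun a x y ↦ by rw [Matrix.add_vecMul])
    (fun s a x ↦ by rw [Matrix.smul_vecMul])

/-- The group functor `H` over the ring of integers `𝔬` of a number field `k` attached to the
change of scalars of `γ_d` to `𝔬`. -/
noncomputable def gammaGroup (k : Type u) [Field k] [NumberField k] (d : ℕ) :
    CommAlgCat.{u} (NumberField.RingOfIntegers k) ⥤ GrpCat.{u} :=
  groupFunctor (changeScalars (gammaRep d) (NumberField.RingOfIntegers k))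

end Gamma

end AskZeta

/-!
Let `A = 𝔬/I`. By Burnside's lemma, `k(H(A)) |H(A)|` counts commuting pairs, so `k(H(A))` is, up to
a power of `|A|`, the sum over pairs `a, b ∈ A ^ d` of the inverse size of the image of the
commutator map `(x, y) ↦ x c_d(b) - y c_d(a)`. By the recursion for `c_d` this image is the product
of the ideals `(a_1, b_1, …, a_i, b_i)`, `i ≤ d`.

Let `J ⊇ I` be the ideal with `J/I = (a_1, b_1)`. Summing over the remaining coordinates leaves the
same count for `𝔬/J` in dimension `d - 1`, and, as `I = D J`, the number of pairs `(a_1, b_1)` that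
generate `J/I ≅ 𝔬/D` depends only on `D`. On Dirichlet series the step from `d - 1` to `d` is thus
multiplication by the series of this count, a shift of `ζ_k(s - 2) / ζ_k(s)` because every pair in
`𝔬/I` generates exactly one ideal; the product over the steps telescopes.

All coefficients being nonnegative, the series of class numbers is dominated by its product with the
denominator and so converges where the numerator does. That `ζ_k` has no zero with `Re s > 1` is
seen by sieving: removing the multiples of all primes from `∑ N(I) ^ (-s)` multiplies it by the
factors `1 - N(P) ^ (-s)` and leaves `1` in the limit.
-/

namespace AskZeta

theorem card_ker_mul_card_range {R V W : Type*} [Ring R] [AddCommGroup V] [AddCommGroup W]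
    [Module R V] [Module R W] (f : V →ₗ[R] W) :
    Nat.card f.ker * Nat.card f.range = Nat.card V := by
  rw [f.ker.card_eq_card_quotient_mul_card, Nat.card_congr f.quotKerEquivRange.toEquiv, mul_comm]

section ClassNumber

namespace SemidirectGroup

variable {R : Type*} [CommRing R] {M V W M' V' W' : Type*}
  [AddCommGroup M] [AddCommGroup V] [AddCommGroup W] [Module R M] [Module R V] [Module R W]
  [AddCommGroup M'] [AddCommGroup V'] [AddCommGroup W'] [Module R M'] [Module R V'] [Module R W']
  {θ : M →ₗ[R] V →ₗ[R] W} {θ' : M' →ₗ[R] V' →ₗ[R] W'}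

/-- An isomorphism of module representations induces an isomorphism of semidirect products. -/
def congr (eM : M ≃ₗ[R] M') (eV : V ≃ₗ[R] V') (eW : W ≃ₗ[R] W')
    (h : ∀ a x, eW (θ a x) = θ' (eM a) (eV x)) : SemidirectGroup θ ≃* SemidirectGroup θ' where
  toFun g := ⟨eM g.act, (eV g.vec.1, eW g.vec.2)⟩
  invFun g := ⟨eM.symm g.act, (eV.symm g.vec.1, eW.symm g.vec.2)⟩
  left_inv g := by simp
  right_inv g := by simp
  map_mul' g g' := by ext <;> simp [mul_def, rightAct, h]

variable (θ)

/-- The forgetful bijection from the semidirect product onto the product of its components. -/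
def equivProd : SemidirectGroup θ ≃ M × V × W where
  toFun g := (g.act, g.vec)
  invFun x := ⟨x.1, x.2⟩

instance [Finite M] [Finite V] [Finite W] : Finite (SemidirectGroup θ) :=
  Finite.of_equiv _ (equivProd θ).symm

/-- The commutator of two elements with components `p.1`, `p.2` in `M` and `x.1`, `x.2` in `V`, as
a linear function of `x`. -/
def commutatorMap (p : M × M) : V × V →ₗ[R] W := (θ p.2).coprod (-θ p.1)

variable {θ} in
theorem commute_iff {g h : SemidirectGroup θ} :
    Commute g h ↔ (g.vec.1, h.vec.1) ∈ (commutatorMap θ (g.act, h.act)).ker := by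
  rw [commute_iff_eq, SemidirectGroup.ext_iff, mul_def, mul_def, LinearMap.mem_ker, commutatorMap]
  simp only [rightAct, Prod.ext_iff, Prod.fst_add, Prod.snd_add, add_comm h.act, add_comm h.vec.1,
    true_and, LinearMap.coprod_apply, LinearMap.neg_apply, ← sub_eq_add_neg, sub_eq_zero]
  rw [add_assoc, add_assoc, add_comm h.vec.2, add_left_inj]

/-- Commuting pairs, split into their components: the components in `W` are unconstrained. -/
def commutingPairsEquiv : {p : SemidirectGroup θ × SemidirectGroup θ // Commute p.1 p.2} ≃
    (Σ p : M × M, (commutatorMap θ p).ker) × (W × W) where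
  toFun p := (⟨(p.1.1.act, p.1.2.act), ⟨_, commute_iff.1 p.2⟩⟩, (p.1.1.vec.2, p.1.2.vec.2))
  invFun q := ⟨(⟨q.1.1.1, (q.1.2.1.1, q.2.1)⟩, ⟨q.1.1.2, (q.1.2.1.2, q.2.2)⟩),
    commute_iff.2 q.1.2.2⟩

theorem classNumber_eq_finsum [Finite M] [Finite V] [Finite W] :
    (classNumber (SemidirectGroup θ) : ℚ) = Nat.card V * Nat.card W / Nat.card M *
      ∑ᶠ p : M × M, (Nat.card (commutatorMap θ p).range : ℚ)⁻¹ := by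
  have := Fintype.ofFinite M
  have card_ker (p : M × M) : (Nat.card (commutatorMap θ p).ker : ℚ) =
      Nat.card V ^ 2 * (Nat.card (commutatorMap θ p).range : ℚ)⁻¹ := by
    rw [eq_mul_inv_iff_mul_eq₀ (by exact_mod_cast Nat.card_pos.ne'), sq]
    exact_mod_cast (card_ker_mul_card_range _).trans (Nat.card_prod V V)
  have burnside : (Nat.card W ^ 2 : ℚ) * ∑ p : M × M, (Nat.card (commutatorMap θ p).ker : ℚ) =
      classNumber (SemidirectGroup θ) * (Nat.card M * (Nat.card V * Nat.card W)) := by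
    have h := card_comm_eq_card_conjClasses_mul_card (SemidirectGroup θ)
    rw [Nat.card_congr (commutingPairsEquiv θ), Nat.card_congr (equivProd θ), Nat.card_prod,
      Nat.card_sigma, Nat.card_prod, Nat.card_prod, Nat.card_prod] at h
    exact_mod_cast (by rw [sq, mul_comm, h, classNumber])
  have hM : (Nat.card M : ℚ) ≠ 0 := by exact_mod_cast Nat.card_pos.ne'
  have hV : (Nat.card V : ℚ) ≠ 0 := by exact_mod_cast Nat.card_pos.ne'
  have hW : (Nat.card W : ℚ) ≠ 0 := by exact_mod_cast Nat.card_pos.ne'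
  simp only [card_ker, ← Finset.mul_sum] at burnside
  rw [finsum_eq_sum_of_fintype, div_mul_eq_mul_div, eq_div_iff hM]
  apply mul_right_cancel₀ (mul_ne_zero hV hW)
  linear_combination -burnside

end SemidirectGroup

theorem classNumber_congr {G H : Type*} [Group G] [Group H] (e : G ≃* H) :
    classNumber G = classNumber H := by
  refine Nat.card_congr (Quotient.congr e.toEquiv fun a b ↦
    ⟨e.toMonoidHom.map_isConj, fun h ↦ ?_⟩)
  change IsConj a b
  simpa only [MulEquiv.toEquiv_eq_coe, EquivLike.coe_coe, MulEquiv.toMonoidHom_eq_coe,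
    MonoidHom.coe_coe, MulEquiv.symm_apply_apply] using e.symm.toMonoidHom.map_isConj h

end ClassNumber

section BaseChange

/-- The module representation `a ↦ c_d(a)` over an arbitrary commutative ring. -/
def cRep (A : Type*) [CommRing A] (d : ℕ) :
    (Fin d → A) →ₗ[A] (Fin ((d + 1).choose 2) → A) →ₗ[A] (Fin d → A) :=
  LinearMap.mk₂ A (fun a x ↦ Matrix.vecMul x (cMatrix d a))
    (fun a b x ↦ by rw [cMatrix_add, Matrix.vecMul_add])
    (fun s a x ↦ by rw [cMatrix_smul, Matrix.vecMul_smul])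
    (fun a x y ↦ by rw [Matrix.add_vecMul])
    (fun s a x ↦ by rw [Matrix.smul_vecMul])

theorem cMatrix_map {A B : Type*} [CommRing A] [CommRing B] (f : A →+* B) (d : ℕ) (X : Fin d → A) :
    (cMatrix d X).map f = cMatrix d (f ∘ X) := by
  induction d with
  | zero => exact Matrix.ext fun _ j ↦ j.elim0
  | succ d ih =>
    ext i j
    obtain ⟨i | i, rfl⟩ := (finSumFinEquiv.trans (finCongr (rows_succ d))).surjective i
    · simp [cMatrix, Matrix.diagonal_apply, apply_ite f]
    · refine Fin.cases ?_ (fun j ↦ ?_) j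
      · simp [cMatrix]
      · have h := congrFun (congrFun (ih fun j ↦ X j.succ) i) j
        simp only [Matrix.map_apply] at h
        simpa [cMatrix, Function.comp_def] using h

theorem map_cRep {A B : Type*} [CommRing A] [CommRing B] (f : A →+* B) (d : ℕ) (a : Fin d → A)
    (x : Fin ((d + 1).choose 2) → A) : f ∘ cRep A d a x = cRep B d (f ∘ a) (f ∘ x) := by
  ext i
  exact (f.map_vecMul _ x i).trans (by rw [cMatrix_map]; rfl)

variable {R : Type*} [CommRing R] (A : Type*) [CommRing A] [Algebra R A]

/-- Extending the scalars of `ℤ ^ n` twice yields `A ^ n`. -/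
noncomputable def baseChangeEquiv (n : ℕ) : A ⊗[R] (R ⊗[ℤ] (Fin n → ℤ)) ≃ₗ[A] (Fin n → A) :=
  (AlgebraTensorModule.cancelBaseChange ℤ R A A (Fin n → ℤ)).trans
    (TensorProduct.piScalarRight ℤ A A (Fin n))

theorem baseChangeEquiv_tmul (n : ℕ) (s : A) (r : R) (x : Fin n → ℤ) :
    baseChangeEquiv A n (s ⊗ₜ (r ⊗ₜ x)) = (r • s) • (Int.castRingHom A ∘ x) := by
  ext i
  simp [baseChangeEquiv, mul_comm]

theorem baseChangeEquiv_changeScalars (d : ℕ) (a : A ⊗[R] (R ⊗[ℤ] (Fin d → ℤ)))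
    (x : A ⊗[R] (R ⊗[ℤ] (Fin ((d + 1).choose 2) → ℤ))) :
    baseChangeEquiv A d (changeScalars (changeScalars (gammaRep d) R) A a x) =
      cRep A d (baseChangeEquiv A d a) (baseChangeEquiv A _ x) := by
  induction a with
  | zero => simp only [map_zero, LinearMap.zero_apply]
  | add a b ha hb => simp only [map_add, LinearMap.add_apply, ha, hb]
  | tmul s a =>
  induction a with
  | zero => simp only [map_zero, LinearMap.zero_apply, tmul_zero]
  | add a b ha hb => simp only [map_add, LinearMap.add_apply, tmul_add, ha, hb]
  | tmul r a =>
  induction x with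
  | zero => simp only [map_zero]
  | add x y hx hy => simp only [map_add, hx, hy]
  | tmul t x =>
  induction x with
  | zero => simp only [map_zero, tmul_zero]
  | add x y hx hy => simp only [map_add, tmul_add, hx, hy]
  | tmul q x =>
    have gammaRep_eq : gammaRep d a x = cRep ℤ d a x := rfl
    simp only [changeScalars_tmul, baseChangeEquiv_tmul, gammaRep_eq, map_cRep, map_smul,
      LinearMap.smul_apply, smul_smul]
    congr 1
    simp only [Algebra.smul_def, map_mul]
    ring

/-- The group `H(A)` attached to `γ_d` is the semidirect product of the matrices `c_d` over `A`. -/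
noncomputable def gammaGroupEquiv (d : ℕ) :
    SemidirectGroup (changeScalars (changeScalars (gammaRep d) R) A) ≃*
      SemidirectGroup (cRep A d) :=
  SemidirectGroup.congr (baseChangeEquiv A _) (baseChangeEquiv A _) (baseChangeEquiv A _)
    (baseChangeEquiv_changeScalars A d)

end BaseChange

section CommutatorIdeals

open SemidirectGroup

/-- The submodule generated by the two entries of a pair. -/
abbrev pairSpan (R : Type*) {M : Type*} [Semiring R] [AddCommMonoid M] [Module R M] (c : M × M) :
    Submodule R M :=
  Submodule.span R {c.1, c.2}

theorem partialSups_fin_zero {α : Type*} [CompleteLattice α] {d : ℕ} (f : Fin (d + 1) → α) :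
    partialSups f 0 = f 0 :=
  partialSups_bot f

theorem partialSups_fin_succ {α : Type*} [CompleteLattice α] {d : ℕ} (f : Fin (d + 1) → α)
    (i : Fin d) : partialSups f i.succ = f 0 ⊔ partialSups (fun j ↦ f j.succ) i := by
  refine le_antisymm (partialSups_le _ _ _ fun j hj ↦ ?_) (sup_le ?_ ?_)
  · cases j using Fin.cases with
    | zero => exact le_sup_left
    | succ j =>
      exact le_sup_of_le_right <|
        le_partialSups_of_le (fun j : Fin d ↦ f j.succ) (Fin.succ_le_succ_iff.1 hj)
  · exact le_partialSups_of_le f (Fin.zero_le _)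
  · exact partialSups_le _ _ _ fun j hj ↦ le_partialSups_of_le f (Fin.succ_le_succ_iff.2 hj)

variable {A : Type*} [CommRing A]

/-- The index set of the rows of `c_{d+1}`: the rows of the scalar block, then those of `c_d`. -/
def rowsEquiv (d : ℕ) : Fin (d + 1) ⊕ Fin ((d + 1).choose 2) ≃ Fin ((d + 1 + 1).choose 2) :=
  finSumFinEquiv.trans (finCongr (rows_succ d))

theorem cRep_succ (d : ℕ) (a : Fin (d + 1) → A) (u : Fin (d + 1) → A)
    (r : Fin ((d + 1).choose 2) → A) :
    cRep A (d + 1) a (Sum.elim u r ∘ (rowsEquiv d).symm) =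
      a 0 • u + (Fin.cons 0 (cRep A d (Fin.tail a) r) : Fin (d + 1) → A) := by
  have h : cMatrix (d + 1) a = (Matrix.fromRows (Matrix.scalar (Fin (d + 1)) (a 0))
      (Matrix.of fun i ↦ Fin.cons 0 (cMatrix d (Fin.tail a) i))).submatrix (rowsEquiv d).symm id :=
    rfl
  rw [cRep, LinearMap.mk₂_apply, h, Matrix.submatrix_vecMul_equiv, Function.comp_assoc,
    Equiv.symm_symm, Equiv.symm_comp_self, Function.comp_id, Function.comp_id,
    Matrix.vecMul_fromRows, Sum.elim_comp_inl, Sum.elim_comp_inr]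
  ext j
  simp only [Pi.add_apply, Matrix.scalar_apply, Matrix.vecMul_diagonal, Pi.smul_apply, smul_eq_mul,
    mul_comm (a 0)]
  congr 1
  refine Fin.cases ?_ (fun j ↦ ?_) j <;> simp [Matrix.vecMul, dotProduct, cRep]

theorem mem_range_commutatorMap_succ {d : ℕ} {a b y : Fin (d + 1) → A} :
    y ∈ (commutatorMap (cRep A (d + 1)) (a, b)).range ↔
      ∃ u v : Fin (d + 1) → A, ∃ z ∈ (commutatorMap (cRep A d) (Fin.tail a, Fin.tail b)).range,
        y = a 0 • u + b 0 • v + (Fin.cons 0 z : Fin (d + 1) → A) := by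
  have commutatorMap_elim (u v : Fin (d + 1) → A) (r q : Fin ((d + 1).choose 2) → A) :
      commutatorMap (cRep A (d + 1)) (a, b)
        (Sum.elim v r ∘ (rowsEquiv d).symm, Sum.elim (-u) q ∘ (rowsEquiv d).symm) =
      a 0 • u + b 0 • v +
        (Fin.cons 0 (commutatorMap (cRep A d) (Fin.tail a, Fin.tail b) (r, q)) :
          Fin (d + 1) → A) := by
    simp only [commutatorMap, LinearMap.coprod_apply, LinearMap.neg_apply, cRep_succ]
    ext j
    refine Fin.cases ?_ (fun j ↦ ?_) j <;> simp <;> ring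
  have exists_elim (x : Fin ((d + 1 + 1).choose 2) → A) :
      ∃ u r, Sum.elim u r ∘ (rowsEquiv d).symm = x :=
    ⟨_, _, by rw [Sum.elim_comp_inl_inr (x ∘ rowsEquiv d), Function.comp_assoc,
      Equiv.self_comp_symm, Function.comp_id]⟩
  constructor
  · rintro ⟨⟨x, x'⟩, rfl⟩
    obtain ⟨v, r, rfl⟩ := exists_elim x
    obtain ⟨u, q, rfl⟩ := exists_elim x'
    exact ⟨-u, v, _, ⟨(r, q), rfl⟩, by rw [← commutatorMap_elim, neg_neg]⟩
  · rintro ⟨u, v, _, ⟨⟨r, q⟩, rfl⟩, rfl⟩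
    exact ⟨_, commutatorMap_elim u v r q⟩

theorem mem_range_commutatorMap {d : ℕ} {a b y : Fin d → A} :
    y ∈ (commutatorMap (cRep A d) (a, b)).range ↔
      ∀ i, y i ∈ partialSups (fun j ↦ pairSpan A (a j, b j)) i := by
  induction d with
  | zero => exact iff_of_true (by rw [Subsingleton.elim y 0]; exact zero_mem _) fun i ↦ i.elim0
  | succ d ih =>
    simp only [mem_range_commutatorMap_succ, ih, Fin.forall_fin_succ, partialSups_fin_zero,
      partialSups_fin_succ, Submodule.mem_sup, Submodule.mem_span_pair]
    constructor
    · rintro ⟨u, v, z, hz, rfl⟩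
      exact ⟨⟨u 0, v 0, by simp [mul_comm]⟩, fun i ↦
        ⟨_, ⟨u i.succ, v i.succ, rfl⟩, z i, hz i, by simp [mul_comm]⟩⟩
    · rintro ⟨⟨u₀, v₀, h₀⟩, h⟩
      choose _ huv z hz hy using h
      choose u v huv using huv
      refine ⟨Fin.cons u₀ u, Fin.cons v₀ v, z, hz, ?_⟩
      ext i
      cases i using Fin.cases with
      | zero => simp [← h₀, mul_comm]
      | succ i => simp [← hy, ← huv, mul_comm]

theorem card_range_commutatorMap [Finite A] {d : ℕ} (a b : Fin d → A) :
    Nat.card (commutatorMap (cRep A d) (a, b)).range =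
      ∏ i, Nat.card (partialSups (fun j ↦ pairSpan A (a j, b j)) i) := by
  rw [← Nat.card_pi]
  exact Nat.card_congr
    ((Equiv.subtypeEquivRight fun _ ↦ mem_range_commutatorMap).trans Equiv.subtypePiEquivPi)

/-- The class number of the group `H(A)` attached to `γ_d`, divided by `|A| ^ C`; see
`classNumber_cRep`. -/
noncomputable def reducedClassNumber (A : Type*) [CommRing A] (d : ℕ) : ℚ :=
  ∑ᶠ p : Fin d → A × A, ∏ i, (Nat.card (partialSups (fun j ↦ pairSpan A (p j)) i) : ℚ)⁻¹

theorem reducedClassNumber_zero : reducedClassNumber A 0 = 1 := by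
  rw [reducedClassNumber, finsum_unique, Finset.univ_eq_empty, Finset.prod_empty]

theorem reducedClassNumber_nonneg (d : ℕ) : 0 ≤ reducedClassNumber A d :=
  finsum_nonneg fun _ ↦ by positivity

theorem classNumber_cRep [Finite A] (d : ℕ) :
    (classNumber (SemidirectGroup (cRep A d)) : ℚ) =
      Nat.card A ^ (d + 1).choose 2 * reducedClassNumber A d := by
  have hA : (Nat.card A : ℚ) ≠ 0 := by exact_mod_cast Nat.card_pos.ne'
  rw [classNumber_eq_finsum, reducedClassNumber, ← finsum_comp_equiv
    (Equiv.arrowProdEquivProdArrow (Fin d) (fun _ ↦ A) (fun _ ↦ A))]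
  simp only [Equiv.arrowProdEquivProdArrow, Equiv.coe_fn_mk, card_range_commutatorMap,
    Nat.cast_prod, Finset.prod_inv_distrib, Nat.card_fun, Nat.card_fin, Nat.cast_pow]
  rw [mul_div_cancel_right₀ _ (pow_ne_zero d hA)]

end CommutatorIdeals

section Recursion

theorem finsum_comp_of_surjective {G H : Type*} [AddGroup G] [AddGroup H] [Finite G]
    {S : Type*} [Semiring S] {φ : G →+ H} (hφ : Function.Surjective φ) (F : H → S) :
    ∑ᶠ g, F (φ g) = Nat.card φ.ker * ∑ᶠ h, F h := by
  classical
  have := Finite.of_surjective φ hφ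
  have := Fintype.ofFinite G
  have := Fintype.ofFinite H
  have card_fiber (h : H) : (Finset.univ.filter (φ · = h)).card = Nat.card φ.ker := by
    rw [AddMonoidHom.card_fiber_eq_of_mem_range φ (hφ h) ⟨0, map_zero φ⟩,
      ← Fintype.card_subtype, ← Nat.card_eq_fintype_card]
    rfl
  rw [finsum_eq_sum_of_fintype, finsum_eq_sum_of_fintype, Finset.sum_comp,
    Finset.image_univ_of_surjective hφ, Finset.mul_sum]
  simp only [card_fiber, nsmul_eq_mul]

theorem card_comap_of_surjective {G H : Type*} [AddGroup G] [AddGroup H] [Finite G] {φ : G →+ H}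
    (hφ : Function.Surjective φ) (K : AddSubgroup H) :
    Nat.card (K.comap φ) = Nat.card φ.ker * Nat.card K := by
  have := Finite.of_surjective φ hφ
  refine Nat.eq_of_mul_eq_mul_right (Nat.pos_of_ne_zero K.index_ne_zero_of_finite) ?_
  rw [← K.index_comap_of_surjective hφ, AddSubgroup.card_mul_index, mul_assoc,
    K.index_comap_of_surjective hφ, K.card_mul_index, ← AddSubgroup.card_top (G := H),
    ← AddMonoidHom.range_eq_top.2 hφ, ← AddSubgroup.index_ker, AddSubgroup.card_mul_index]

variable {A B : Type*} [CommRing A] [CommRing B]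

theorem card_ker_sup [Finite A] {f : A →+* B} (hf : Function.Surjective f) (K : Ideal A) :
    Nat.card ↥(RingHom.ker f ⊔ K) = Nat.card (RingHom.ker f) * Nat.card (K.map f) := by
  rw [sup_comm, RingHom.ker_eq_comap_bot, ← Ideal.comap_map_of_surjective f hf]
  exact card_comap_of_surjective (φ := f.toAddMonoidHom) hf (K.map f).toAddSubgroup

theorem map_partialSups_pairSpan (f : A →+* B) {ι : Type*} [Preorder ι] [LocallyFiniteOrderBot ι]
    (p : ι → A × A) (i : ι) :
    Ideal.map f (partialSups (fun j ↦ pairSpan A (p j)) i) =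
      partialSups (fun j ↦ pairSpan B (Prod.map f f (p j))) i := by
  have map_pairSpan (c : A × A) : Ideal.map f (pairSpan A c) = pairSpan B (Prod.map f f c) := by
    rw [pairSpan, ← Ideal.span, Ideal.map_span, Set.image_pair]
    rfl
  simp only [partialSups_eq_biSup, Ideal.map_iSup, map_pairSpan]

theorem finsum_prod_ker_sup [Finite A] {f : A →+* B} (hf : Function.Surjective f) (d : ℕ) :
    ∑ᶠ p : Fin d → A × A, ∏ i, (Nat.card ↥(RingHom.ker f ⊔
      partialSups (fun j ↦ pairSpan A (p j)) i) : ℚ)⁻¹ =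
    Nat.card (RingHom.ker f) ^ d * reducedClassNumber B d := by
  let φ : (Fin d → A × A) →+ (Fin d → B × B) :=
    (f.toAddMonoidHom.prodMap f.toAddMonoidHom).compLeft (Fin d)
  have hφ : Function.Surjective φ := (hf.prodMap hf).comp_left
  have card_ker : Nat.card φ.ker = Nat.card (RingHom.ker f) ^ (2 * d) := by
    have mem_ker (p : Fin d → A × A) :
        p ∈ φ.ker ↔ ∀ i, (p i).1 ∈ RingHom.ker f ∧ (p i).2 ∈ RingHom.ker f := by
      simp only [φ, AddMonoidHom.mem_ker, funext_iff, Prod.ext_iff, RingHom.mem_ker]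
      rfl
    let e : φ.ker ≃ (Fin d → RingHom.ker f × RingHom.ker f) :=
      (Equiv.subtypeEquivRight mem_ker).trans <|
        (Equiv.subtypePiEquivPi
          (p := fun _ (c : A × A) ↦ c.1 ∈ RingHom.ker f ∧ c.2 ∈ RingHom.ker f)).trans <|
        Equiv.piCongrRight fun _ ↦ Equiv.subtypeProdEquivProd
    rw [Nat.card_congr e, Nat.card_fun, Nat.card_prod, Nat.card_fin, ← sq, pow_mul]
  have hK : (Nat.card (RingHom.ker f) : ℚ) ≠ 0 := by exact_mod_cast Nat.card_pos.ne'
  have h := finsum_comp_of_surjective hφ fun q ↦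
    ∏ i, (Nat.card (partialSups (fun j ↦ pairSpan B (q j)) i) : ℚ)⁻¹
  rw [card_ker] at h
  simp only [card_ker_sup hf, map_partialSups_pairSpan, Nat.cast_mul, mul_inv,
    Finset.prod_mul_distrib, Finset.prod_const, Finset.card_univ, Fintype.card_fin]
  rw [← mul_finsum]
  refine (congrArg _ h).trans ?_
  rw [← reducedClassNumber, Nat.cast_pow, two_mul, pow_add, ← mul_assoc, ← mul_assoc, ← mul_pow,
    inv_mul_cancel₀ hK, one_pow, one_mul]

theorem reducedClassNumber_congr [Finite A] (e : A ≃+* B) (d : ℕ) :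
    reducedClassNumber A d = reducedClassNumber B d := by
  have h := finsum_prod_ker_sup (f := e.toRingHom) e.surjective d
  have ker_eq_bot : RingHom.ker e.toRingHom = ⊥ :=
    (RingHom.injective_iff_ker_eq_bot _).1 e.injective
  simp only [ker_eq_bot, bot_sup_eq, Nat.card_unique, Nat.cast_one, one_pow, one_mul] at h
  exact h

theorem reducedClassNumber_succ [Finite A] (d : ℕ) :
    reducedClassNumber A (d + 1) = ∑ᶠ c : A × A,
      (Nat.card (pairSpan A c) : ℚ) ^ (d - 1 : ℤ) * reducedClassNumber (A ⧸ pairSpan A c) d := by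
  have := Fintype.ofFinite A
  have h (c : A × A) := finsum_prod_ker_sup (Ideal.Quotient.mk_surjective (I := pairSpan A c)) d
  simp only [Ideal.mk_ker] at h
  rw [reducedClassNumber, ← finsum_comp_equiv (Fin.consEquiv fun _ ↦ A × A),
    finsum_eq_sum_of_fintype, Fintype.sum_prod_type, finsum_eq_sum_of_fintype]
  refine Finset.sum_congr rfl fun c _ ↦ ?_
  have hc : (Nat.card (pairSpan A c) : ℚ) ≠ 0 := by exact_mod_cast Nat.card_pos.ne'
  simp only [Fin.prod_univ_succ, partialSups_fin_zero, partialSups_fin_succ, Fin.consEquiv,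
    Equiv.coe_fn_mk, Fin.cons_zero, Fin.cons_succ]
  rw [← Finset.mul_sum, ← finsum_eq_sum_of_fintype, h, zpow_sub_one₀ hc, zpow_natCast]
  ring

end Recursion

section GeneratingPairs

/-- The number of pairs of elements generating the module `M`. For `M = R ⧸ D` it plays the role
of Jordan's totient `J₂` of the ideal `D`. -/
noncomputable def generatingPairCount (R M : Type*) [Semiring R] [AddCommMonoid M] [Module R M] :
    ℕ :=
  Nat.card {p : M × M // pairSpan R p = ⊤}

section Modules

variable {R M M' : Type*} [Semiring R] [AddCommMonoid M] [AddCommMonoid M'] [Module R M]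
  [Module R M']

theorem map_pairSpan (f : M →ₗ[R] M') (p : M × M) :
    (pairSpan R p).map f = pairSpan R (Prod.map f f p) := by
  rw [pairSpan, Submodule.map_span, Set.image_pair]
  rfl

theorem generatingPairCount_congr (e : M ≃ₗ[R] M') :
    generatingPairCount R M = generatingPairCount R M' := by
  refine Nat.card_congr ((e.toEquiv.prodCongr e.toEquiv).subtypeEquiv fun p ↦ ?_)
  rw [← (Submodule.map_injective_of_injective e.injective).eq_iff, Submodule.map_top,
    LinearEquiv.range]
  exact Eq.congr_left (map_pairSpan e.toLinearMap p)

theorem card_pairSpan_eq (N : Submodule R M) :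
    Nat.card {p : M × M // pairSpan R p = N} = generatingPairCount R N := by
  have mem_of_eq {p : M × M} (hp : pairSpan R p = N) : p.1 ∈ N ∧ p.2 ∈ N :=
    hp ▸ ⟨Submodule.subset_span (by simp), Submodule.subset_span (by simp)⟩
  have span_eq_top_iff (p : N × N) :
      pairSpan R p = ⊤ ↔ pairSpan R ((p.1 : M), (p.2 : M)) = N := by
    rw [← (Submodule.map_injective_of_injective N.subtype_injective).eq_iff,
      Submodule.map_subtype_top]
    exact Eq.congr_left (map_pairSpan N.subtype p)
  exact Nat.card_congr
    { toFun := fun p ↦ ⟨(⟨p.1.1, (mem_of_eq p.2).1⟩, ⟨p.1.2, (mem_of_eq p.2).2⟩),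
        (span_eq_top_iff _).2 p.2⟩
      invFun := fun q ↦ ⟨(q.1.1, q.1.2), (span_eq_top_iff _).1 q.2⟩ }

end Modules

variable {R : Type*} [CommRing R]

/-- The ideal of `R` generated by `I` and representatives of two elements of `R/I`. -/
def pairIdeal (I : Ideal R) (p : (R ⧸ I) × (R ⧸ I)) : Ideal R :=
  Ideal.comap (Ideal.Quotient.mk I) (pairSpan (R ⧸ I) p)

theorem le_pairIdeal (I : Ideal R) (p : (R ⧸ I) × (R ⧸ I)) : I ≤ pairIdeal I p :=
  Ideal.mk_ker.ge.trans (Ideal.ker_le_comap _)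

theorem map_mk_pairIdeal (I : Ideal R) (p : (R ⧸ I) × (R ⧸ I)) :
    (pairIdeal I p).map (Ideal.Quotient.mk I) = pairSpan (R ⧸ I) p :=
  Ideal.map_comap_of_surjective _ Ideal.Quotient.mk_surjective _

theorem pairIdeal_eq_iff {I J : Ideal R} (h : I ≤ J) (p : (R ⧸ I) × (R ⧸ I)) :
    pairIdeal I p = J ↔ pairSpan R p = Submodule.map I.mkQ J := by
  have pairIdeal_eq : pairIdeal I p = (pairSpan R p).comap I.mkQ := by
    rw [pairSpan, ← Submodule.restrictScalars_span R (R ⧸ I) Ideal.Quotient.mk_surjective]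
    rfl
  rw [pairIdeal_eq]
  constructor
  · rintro rfl
    rw [Submodule.map_comap_eq_of_surjective I.mkQ_surjective]
  · intro hp
    rw [hp, Submodule.comap_map_mkQ, sup_eq_right.2 h]

/-- The quotient by `pairIdeal I p` as an iterated quotient. -/
noncomputable def quotPairSpanEquiv (I : Ideal R) (p : (R ⧸ I) × (R ⧸ I)) :
    (R ⧸ I) ⧸ pairSpan (R ⧸ I) p ≃+* R ⧸ pairIdeal I p :=
  (Ideal.quotEquivOfEq (map_mk_pairIdeal I p).symm).trans
    (DoubleQuot.quotQuotEquivQuotOfLE (le_pairIdeal I p))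

/-- By the Chinese remainder theorem, `J` is generated by `D J` and a single element `t`;
multiplication by `t` is the isomorphism. -/
theorem nonempty_quotient_equiv_map_mkQ [IsDedekindDomain R] {D J : Ideal R} (h : D * J ≠ ⊥) :
    Nonempty ((R ⧸ D) ≃ₗ[R] Submodule.map (Submodule.mkQ (D * J)) J) := by
  obtain ⟨t, ht⟩ := IsDedekindDomain.exists_sup_span_eq (Ideal.mul_le_right : D * J ≤ J) h
  have hJ : J ≠ 0 := by
    rintro rfl
    exact h (mul_zero D)
  let f : R →ₗ[R] R ⧸ (D * J) := LinearMap.toSpanSingleton R _ (Submodule.mkQ (D * J) t)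
  have mem_ker (x : R) : x ∈ f.ker ↔ x * t ∈ D * J := by
    rw [LinearMap.mem_ker, LinearMap.toSpanSingleton_apply, ← map_smul, Submodule.mkQ_apply,
      Submodule.Quotient.mk_eq_zero, smul_eq_mul]
  have ker_eq : f.ker = D := by
    refine le_antisymm (fun x hx ↦ ?_) fun x hx ↦ (mem_ker x).2 <| Ideal.mul_mem_mul hx <|
      ht ▸ Ideal.mem_sup_right (Ideal.mem_span_singleton_self t)
    rw [← Ideal.span_singleton_le_iff_mem, ← Ideal.dvd_iff_le, ← mul_dvd_mul_iff_right hJ,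
      Ideal.dvd_iff_le]
    nth_rewrite 1 [← ht]
    rw [Ideal.mul_sup, Ideal.span_singleton_mul_span_singleton]
    exact sup_le Ideal.mul_le_right ((Ideal.span_singleton_le_iff_mem _).2 ((mem_ker x).1 hx))
  have range_eq : f.range = Submodule.map (Submodule.mkQ (D * J)) J := by
    have map_ht := congrArg (Submodule.map (Submodule.mkQ (D * J))) ht
    rw [Submodule.map_sup, Submodule.mkQ_map_self, bot_sup_eq, Ideal.span, Submodule.map_span,
      Set.image_singleton] at map_ht
    rw [LinearMap.range_toSpanSingleton, map_ht]
  exact ⟨(Submodule.quotEquivOfEq _ _ ker_eq.symm).trans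
    (f.quotKerEquivRange.trans (LinearEquiv.ofEq _ _ range_eq))⟩

theorem card_pairIdeal_eq [IsDedekindDomain R] {D J : Ideal R} (h : D * J ≠ ⊥) :
    Nat.card {p : (R ⧸ (D * J)) × (R ⧸ (D * J)) // pairIdeal (D * J) p = J} =
      generatingPairCount R (R ⧸ D) := by
  obtain ⟨e⟩ := nonempty_quotient_equiv_map_mkQ h
  rw [generatingPairCount_congr e, ← card_pairSpan_eq]
  exact Nat.card_congr (Equiv.subtypeEquivRight (pairIdeal_eq_iff Ideal.mul_le_right))

end GeneratingPairs

section IdealSeries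

variable {R : Type*} [CommRing R] [IsDedekindDomain R] [Module.Free ℤ R]

theorem card_pairSpan_mul_absNorm (I : Ideal R) (p : (R ⧸ I) × (R ⧸ I)) :
    Nat.card (pairSpan (R ⧸ I) p) * Ideal.absNorm (pairIdeal I p) = Ideal.absNorm I := by
  simp only [Ideal.absNorm_apply, Submodule.cardQuot_apply]
  rw [(pairSpan (R ⧸ I) p).card_eq_card_quotient_mul_card, mul_comm,
    Nat.card_congr (quotPairSpanEquiv I p).toEquiv, mul_comm]

variable [Module.Finite ℤ R]

theorem finite_quotient_of_ne_bot {I : Ideal R} (hI : I ≠ ⊥) : Finite (R ⧸ I) := by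
  rwa [← Ideal.absNorm_ne_zero_iff, Ne, Ideal.absNorm_eq_zero_iff]

theorem absNorm_ne_zero_of_ne_bot {I : Ideal R} (hI : I ≠ ⊥) : (Ideal.absNorm I : ℚ) ≠ 0 := by
  rwa [Nat.cast_ne_zero, Ne, Ideal.absNorm_eq_zero_iff]

variable [CharZero R]

variable (R) in
/-- The finite set of ideals of norm `n` (empty for `n = 0`, which leaves out the zero ideal). -/
noncomputable def idealsOfNorm (n : ℕ) : Finset (Ideal R) :=
  (((Ideal.finite_setOfPred_absNorm_eq (S := R) n).subset
    (fun _ h ↦ h.1 : {I : Ideal R | Ideal.absNorm I = n ∧ n ≠ 0} ⊆ _))).toFinset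

@[simp]
theorem mem_idealsOfNorm {n : ℕ} {I : Ideal R} :
    I ∈ idealsOfNorm R n ↔ Ideal.absNorm I = n ∧ n ≠ 0 := by
  simp [idealsOfNorm]

theorem finite_setOf_mul_eq (I : Ideal R) :
    {x : Ideal R × Ideal R | x.1 * x.2 = I ∧ I ≠ ⊥}.Finite := by
  refine ((Ideal.finite_setOfPred_absNorm_le (S := R) (Ideal.absNorm I)).prod
    (Ideal.finite_setOfPred_absNorm_le (S := R) (Ideal.absNorm I))).subset ?_
  rintro ⟨D, J⟩ ⟨rfl, hI⟩
  have absNorm_pos : 0 < Ideal.absNorm (D * J) :=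
    Nat.pos_of_ne_zero (mt Ideal.absNorm_eq_zero_iff.1 hI)
  exact ⟨Nat.le_of_dvd absNorm_pos (map_dvd _ (dvd_mul_right D J)),
    Nat.le_of_dvd absNorm_pos (map_dvd _ (dvd_mul_left J D))⟩

/-- The finite set of factorizations of a nonzero ideal as a product of two ideals (empty for the
zero ideal). -/
noncomputable def idealAntidiagonal (I : Ideal R) : Finset (Ideal R × Ideal R) :=
  (finite_setOf_mul_eq I).toFinset

@[simp]
theorem mem_idealAntidiagonal {I : Ideal R} {x : Ideal R × Ideal R} :
    x ∈ idealAntidiagonal I ↔ x.1 * x.2 = I ∧ I ≠ ⊥ := by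
  simp [idealAntidiagonal]

theorem ne_bot_of_mem_idealAntidiagonal {I : Ideal R} {x : Ideal R × Ideal R}
    (hx : x ∈ idealAntidiagonal I) : x.1 ≠ ⊥ ∧ x.2 ≠ ⊥ := by
  rw [mem_idealAntidiagonal] at hx
  exact mul_ne_zero_iff.1 (hx.1.trans_ne hx.2)

theorem absNorm_of_mem_idealAntidiagonal {I : Ideal R} {x : Ideal R × Ideal R}
    (hx : x ∈ idealAntidiagonal I) :
    (Ideal.absNorm I : ℚ) = Ideal.absNorm x.1 * Ideal.absNorm x.2 := by
  rw [← (mem_idealAntidiagonal.1 hx).1, map_mul, Nat.cast_mul]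

theorem finsum_pairIdeal {I : Ideal R} (hI : I ≠ ⊥) (F : Ideal R → ℚ) :
    ∑ᶠ p : (R ⧸ I) × (R ⧸ I), F (pairIdeal I p) =
      ∑ x ∈ idealAntidiagonal I, (generatingPairCount R (R ⧸ x.1) : ℚ) * F x.2 := by
  classical
  have := finite_quotient_of_ne_bot hI
  have := Fintype.ofFinite (R ⧸ I)
  have exists_cofactor (p : (R ⧸ I) × (R ⧸ I)) : ∃ D, D * pairIdeal I p = I :=
    (exists_eq_mul_left_of_dvd (Ideal.dvd_iff_le.2 (le_pairIdeal I p))).imp fun _ h ↦ h.symm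
  choose cofactor cofactor_mul using exists_cofactor
  rw [finsum_eq_sum_of_fintype, ← Finset.sum_fiberwise_of_maps_to (t := idealAntidiagonal I)
    (g := fun p ↦ (cofactor p, pairIdeal I p)) fun p _ ↦
      mem_idealAntidiagonal.2 ⟨cofactor_mul p, hI⟩]
  refine Finset.sum_congr rfl fun x hx ↦ ?_
  obtain ⟨D, J⟩ := x
  have hJ : J ≠ 0 := (ne_bot_of_mem_idealAntidiagonal hx).2
  obtain ⟨rfl, -⟩ := mem_idealAntidiagonal.1 hx
  have fiber_iff (p) : (cofactor p, pairIdeal (D * J) p) = (D, J) ↔ pairIdeal (D * J) p = J := by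
    refine ⟨fun h ↦ (Prod.ext_iff.1 h).2, fun h ↦ Prod.ext (mul_right_cancel₀ hJ ?_) h⟩
    simpa only [h] using cofactor_mul p
  simp only [fiber_iff]
  rw [← card_pairIdeal_eq hI, Nat.card_eq_fintype_card, Fintype.card_subtype, ← nsmul_eq_mul]
  exact Finset.sum_eq_card_nsmul fun p hp ↦ by rw [(Finset.mem_filter.1 hp).2]

theorem sum_generatingPairCount {I : Ideal R} (hI : I ≠ ⊥) :
    ∑ x ∈ idealAntidiagonal I, (generatingPairCount R (R ⧸ x.1) : ℚ) = Ideal.absNorm I ^ 2 := by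
  have := finite_quotient_of_ne_bot hI
  have := Fintype.ofFinite (R ⧸ I)
  have h := finsum_pairIdeal hI fun _ ↦ 1
  simp only [mul_one, finsum_eq_sum_of_fintype, Finset.sum_const, Finset.card_univ,
    Fintype.card_prod, nsmul_eq_mul] at h
  rw [← h, Ideal.absNorm_apply, Submodule.cardQuot_apply, Nat.card_eq_fintype_card, sq,
    Nat.cast_mul]

theorem reducedClassNumber_quotient_succ {I : Ideal R} (hI : I ≠ ⊥) (d : ℕ) :
    reducedClassNumber (R ⧸ I) (d + 1) = ∑ x ∈ idealAntidiagonal I,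
      generatingPairCount R (R ⧸ x.1) * (Ideal.absNorm x.1 : ℚ) ^ (d - 1 : ℤ) *
        reducedClassNumber (R ⧸ x.2) d := by
  have := finite_quotient_of_ne_bot hI
  have card_pairSpan (p : (R ⧸ I) × (R ⧸ I)) : (Nat.card (pairSpan (R ⧸ I) p) : ℚ) =
      Ideal.absNorm I / Ideal.absNorm (pairIdeal I p) := by
    rw [eq_div_iff (absNorm_ne_zero_of_ne_bot (ne_bot_of_le_ne_bot hI (le_pairIdeal I p)))]
    exact_mod_cast card_pairSpan_mul_absNorm I p
  have congr_quot (p : (R ⧸ I) × (R ⧸ I)) :=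
    have := Finite.of_surjective _ (Ideal.Quotient.mk_surjective (I := pairSpan (R ⧸ I) p))
    reducedClassNumber_congr (quotPairSpanEquiv I p) d
  simp only [reducedClassNumber_succ, card_pairSpan, congr_quot]
  rw [finsum_pairIdeal hI fun J ↦
    (Ideal.absNorm I / Ideal.absNorm J : ℚ) ^ (d - 1 : ℤ) * reducedClassNumber (R ⧸ J) d]
  refine Finset.sum_congr rfl fun x hx ↦ ?_
  rw [absNorm_of_mem_idealAntidiagonal hx, mul_div_cancel_right₀ _
    (absNorm_ne_zero_of_ne_bot (ne_bot_of_mem_idealAntidiagonal hx).2), mul_assoc]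

/-- The formal Dirichlet series `∑ f(I) N(I)^{-s}` over the nonzero ideals `I`. -/
noncomputable def idealSeries (f : Ideal R → ℚ) : ArithmeticFunction ℚ where
  toFun n := ∑ I ∈ idealsOfNorm R n, f I
  map_zero' := Finset.sum_eq_zero fun _ hI ↦ ((mem_idealsOfNorm.1 hI).2 rfl).elim

theorem idealSeries_apply (f : Ideal R → ℚ) (n : ℕ) :
    idealSeries f n = ∑ I ∈ idealsOfNorm R n, f I := rfl

theorem idealSeries_congr {f g : Ideal R → ℚ} (h : ∀ I ≠ ⊥, f I = g I) :
    idealSeries f = idealSeries g := by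
  ext n
  refine Finset.sum_congr rfl fun I hI ↦ h I fun hI0 ↦ ?_
  obtain ⟨rfl, hn⟩ := mem_idealsOfNorm.1 hI
  exact hn (Ideal.absNorm_eq_zero_iff.2 hI0)

theorem idealSeries_apply_one (f : Ideal R → ℚ) : idealSeries f 1 = f ⊤ := by
  have idealsOfNorm_one : idealsOfNorm R 1 = {⊤} := by
    ext I
    simp
  rw [idealSeries_apply, idealsOfNorm_one, Finset.sum_singleton]

theorem idealSeries_nonneg {f : Ideal R → ℚ} (hf : ∀ I, 0 ≤ f I) (n : ℕ) : 0 ≤ idealSeries f n :=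
  Finset.sum_nonneg fun I _ ↦ hf I

theorem idealSeries_mul (f g : Ideal R → ℚ) :
    idealSeries f * idealSeries g =
      idealSeries fun I ↦ ∑ x ∈ idealAntidiagonal I, f x.1 * g x.2 := by
  ext n
  rw [ArithmeticFunction.mul_apply, idealSeries_apply, Finset.sum_sigma']
  simp only [idealSeries_apply, Finset.sum_mul_sum, ← Finset.sum_product']
  rw [Finset.sum_sigma']
  refine Finset.sum_bij' (fun x _ ↦ ⟨x.2.1 * x.2.2, x.2⟩)
    (fun y _ ↦ ⟨(Ideal.absNorm y.2.1, Ideal.absNorm y.2.2), y.2⟩) ?_ ?_ ?_ ?_ fun _ _ ↦ rfl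
  · rintro ⟨⟨m₁, m₂⟩, ⟨D, J⟩⟩ h
    simp only [Finset.mem_sigma, Nat.mem_divisorsAntidiagonal, Finset.mem_product,
      mem_idealsOfNorm, mem_idealAntidiagonal, map_mul] at h ⊢
    obtain ⟨⟨rfl, hn⟩, ⟨rfl, -⟩, rfl, -⟩ := h
    exact ⟨⟨rfl, hn⟩, trivial, by rwa [Ne, ← Ideal.absNorm_eq_zero_iff, map_mul]⟩
  · rintro ⟨I, ⟨D, J⟩⟩ h
    simp only [Finset.mem_sigma, Nat.mem_divisorsAntidiagonal, Finset.mem_product,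
      mem_idealsOfNorm, mem_idealAntidiagonal] at h ⊢
    obtain ⟨⟨rfl, hn⟩, rfl, -⟩ := h
    rw [map_mul] at hn ⊢
    exact ⟨⟨rfl, hn⟩, ⟨trivial, left_ne_zero_of_mul hn⟩, trivial, right_ne_zero_of_mul hn⟩
  · rintro ⟨⟨m₁, m₂⟩, ⟨D, J⟩⟩ h
    simp only [Finset.mem_sigma, Finset.mem_product, mem_idealsOfNorm] at h
    obtain ⟨-, ⟨rfl, -⟩, rfl, -⟩ := h
    rfl
  · rintro ⟨I, ⟨D, J⟩⟩ h
    simp only [Finset.mem_sigma, mem_idealAntidiagonal] at h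
    obtain ⟨-, rfl, -⟩ := h
    rfl

variable (R) in
/-- The shifted zeta function `ζ_R(s - c)` of `R` as a formal Dirichlet series. -/
noncomputable def shiftedZeta (c : ℤ) : ArithmeticFunction ℚ :=
  idealSeries fun I : Ideal R ↦ (Ideal.absNorm I : ℚ) ^ c

theorem shiftedZeta_apply_one (c : ℤ) : shiftedZeta R c 1 = 1 := by
  rw [shiftedZeta, idealSeries_apply_one, Ideal.absNorm_top, Nat.cast_one, one_zpow]

theorem isUnit_shiftedZeta (c : ℤ) : IsUnit (shiftedZeta R c) := by
  rw [ArithmeticFunction.isUnit_iff_isUnit_apply_one, shiftedZeta_apply_one]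
  exact isUnit_one

theorem generatingPairCount_mul_shiftedZeta (c : ℤ) :
    idealSeries (fun I : Ideal R ↦ generatingPairCount R (R ⧸ I) * (Ideal.absNorm I : ℚ) ^ c) *
      shiftedZeta R c = shiftedZeta R (c + 2) := by
  rw [shiftedZeta, idealSeries_mul]
  refine idealSeries_congr fun I hI ↦ ?_
  rw [zpow_add₀ (absNorm_ne_zero_of_ne_bot hI), zpow_ofNat, ← sum_generatingPairCount hI,
    Finset.mul_sum]
  refine Finset.sum_congr rfl fun x hx ↦ ?_
  rw [absNorm_of_mem_idealAntidiagonal hx, mul_zpow]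
  ring

theorem generatingPairCount_mul_reducedClassNumber (d : ℕ) (c : ℤ) :
    idealSeries (fun I : Ideal R ↦
        generatingPairCount R (R ⧸ I) * (Ideal.absNorm I : ℚ) ^ (c + d - 1)) *
      idealSeries (fun I : Ideal R ↦ reducedClassNumber (R ⧸ I) d * (Ideal.absNorm I : ℚ) ^ c) =
    idealSeries fun I : Ideal R ↦
      reducedClassNumber (R ⧸ I) (d + 1) * (Ideal.absNorm I : ℚ) ^ c := by
  rw [idealSeries_mul]
  refine idealSeries_congr fun I hI ↦ ?_
  rw [reducedClassNumber_quotient_succ hI d, Finset.sum_mul]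
  refine Finset.sum_congr rfl fun x hx ↦ ?_
  rw [absNorm_of_mem_idealAntidiagonal hx, mul_zpow, add_sub_assoc,
    zpow_add₀ (absNorm_ne_zero_of_ne_bot (ne_bot_of_mem_idealAntidiagonal hx).1)]
  ring

/-- Induction on `d`: writing `ψ` for the series of generating pairs at `c + d - 1`, one step
multiplies the left side by `ψ`, and `ψ ζ(c + d - 1) = ζ(c + d + 1)`. -/
theorem reducedClassNumber_mul_shiftedZeta (d : ℕ) (c : ℤ) :
    idealSeries (fun I : Ideal R ↦ reducedClassNumber (R ⧸ I) d * (Ideal.absNorm I : ℚ) ^ c) *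
      shiftedZeta R (c - 1) = shiftedZeta R (c + d) * shiftedZeta R (c + d - 1) := by
  induction d with
  | zero => simp [reducedClassNumber_zero, shiftedZeta]
  | succ d ih =>
    have shift : c + (d + 1 : ℕ) = c + d - 1 + 2 := by
      push_cast
      ring
    rw [← generatingPairCount_mul_reducedClassNumber, mul_assoc, ih, shift,
      ← generatingPairCount_mul_shiftedZeta, show c + d - 1 + 2 - 1 = c + d by ring]
    ring

end IdealSeries

section Nonvanishing

open Filter Topology

variable {α : Type*} [CommMonoidWithZero α]

/-- The elements of a commutative monoid with zero not divisible by any of the primes in `P`. -/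
def sifted (P : Finset {p : α // Prime p}) : Set α :=
  {x | ∀ p ∈ P, ¬ p.1 ∣ x}

variable [Subsingleton αˣ] {𝕜 : Type*} [NormedField 𝕜]

theorem mul_mem_sifted_iff [IsCancelMulZero α] {P : Finset {p : α // Prime p}}
    {p : {p : α // Prime p}} (hp : p ∉ P) {x : α} : p.1 * x ∈ sifted P ↔ x ∈ sifted P := by
  refine forall₂_congr fun q hq ↦ not_congr ⟨fun h ↦ ?_, fun h ↦ h.mul_left p.1⟩
  refine (q.2.dvd_or_dvd h).resolve_left fun hqp ↦ hp ?_
  rwa [← Subtype.ext (associated_iff_eq.1 (q.2.associated_of_dvd p.2 hqp))]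

theorem tsum_indicator_dvd_sifted [IsCancelMulZero α] (a : α →*₀ 𝕜) {P : Finset {p : α // Prime p}}
    {p : {p : α // Prime p}} (hp : p ∉ P) :
    ∑' x, ({x | p.1 ∣ x} ∩ sifted P).indicator a x = a p * ∑' x, (sifted P).indicator a x := by
  classical
  rw [← tsum_mul_left, ← (mul_right_injective₀ p.2.ne_zero).tsum_eq]
  · refine tsum_congr fun x ↦ ?_
    simp [Set.indicator_apply, mul_mem_sifted_iff hp]
  · intro x hx
    obtain ⟨y, rfl⟩ := (Set.mem_of_indicator_ne_zero hx).1
    exact ⟨y, rfl⟩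

variable [CompleteSpace 𝕜] (a : α →*₀ 𝕜) (ha : Summable fun x ↦ ‖a x‖)

include ha

theorem tsum_indicator_sifted [IsCancelMulZero α] (P : Finset {p : α // Prime p}) :
    ∑' x, (sifted P).indicator a x = (∏ p ∈ P, (1 - a p)) * ∑' x, a x := by
  classical
  induction P using Finset.induction_on with
  | empty => simp [sifted]
  | insert p P hp ih =>
    have split : sifted (insert p P) = sifted P \ ({x | p.1 ∣ x} ∩ sifted P) := by
      ext x
      simp only [sifted, Finset.forall_mem_insert, Set.mem_sdiff, Set.mem_inter_iff,
        Set.mem_ofPred_eq]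
      tauto
    rw [split, Set.indicator_sdiff Set.inter_subset_right, Finset.prod_insert hp, mul_assoc, ← ih,
      sub_mul, one_mul, ← tsum_indicator_dvd_sifted a hp]
    exact (ha.of_norm.indicator _).tsum_sub (ha.of_norm.indicator _)

theorem tendsto_tsum_indicator_sifted [UniqueFactorizationMonoid α] :
    Tendsto (fun P : Finset {p : α // Prime p} ↦ ∑' x, (sifted P).indicator a x) atTop (𝓝 1) := by
  classical
  rw [← tsum_ite_eq (1 : α) fun _ ↦ (1 : 𝕜)]
  refine tendsto_tsum_of_dominated_convergence ha (fun x ↦ ?_)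
    (.of_forall fun P x ↦ norm_indicator_le_norm_self a x)
  apply tendsto_nhds_of_eventually_eq
  rcases eq_or_ne x 1 with rfl | hx1
  · refine .of_forall fun P ↦ ?_
    have one_mem : (1 : α) ∈ sifted P := fun p _ h ↦ p.2.not_isUnit (isUnit_of_dvd_one h)
    rw [Set.indicator_of_mem one_mem, map_one, if_pos rfl]
  rcases eq_or_ne x 0 with rfl | hx0
  · simp [Set.indicator_apply, hx1]
  · obtain ⟨p, hp, hpx⟩ := WfDvdMonoid.exists_irreducible_factor (mt isUnit_iff_eq_one.1 hx1) hx0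
    filter_upwards [eventually_ge_atTop {⟨p, hp.prime⟩}] with P hP
    rw [if_neg hx1]
    have notMem : x ∉ sifted P := fun h ↦ h _ (Finset.singleton_subset_iff.1 hP) hpx
    exact Set.indicator_of_notMem notMem a

theorem tsum_monoidWithZeroHom_ne_zero [UniqueFactorizationMonoid α] : ∑' x, a x ≠ 0 := by
  intro h
  have tendsto_one := tendsto_tsum_indicator_sifted a ha
  simp only [tsum_indicator_sifted a ha, h, mul_zero] at tendsto_one
  exact zero_ne_one (tendsto_nhds_unique tendsto_const_nhds tendsto_one)

end Nonvanishing

section Convergence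

variable {R : Type*} [CommRing R] [IsDedekindDomain R] [Module.Free ℤ R] [Module.Finite ℤ R]
  [CharZero R]

variable (R) in
/-- The ideals of finite index, sorted by their norms. -/
noncomputable def sigmaIdealsOfNormEquiv :
    (Σ n : ℕ, idealsOfNorm R n) ≃ {I : Ideal R // Finite (R ⧸ I)} where
  toFun x := ⟨x.2.1, by
    obtain ⟨norm_eq, hn⟩ := mem_idealsOfNorm.1 x.2.2
    rwa [← Ideal.absNorm_ne_zero_iff, norm_eq]⟩
  invFun I := ⟨Ideal.absNorm I.1, I.1,
    mem_idealsOfNorm.2 ⟨rfl, (Ideal.absNorm_ne_zero_iff _).2 I.2⟩⟩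
  left_inv := by
    rintro ⟨n, I, hI⟩
    obtain ⟨rfl, -⟩ := mem_idealsOfNorm.1 hI
    rfl
  right_inv _ := rfl

theorem term_idealSeries (f : Ideal R → ℚ) (s : ℂ) (n : ℕ) :
    LSeries.term (fun n ↦ (idealSeries f n : ℂ)) s n =
      ∑ I ∈ idealsOfNorm R n, (f I : ℂ) * (Ideal.absNorm I : ℂ) ^ (-s) := by
  rw [LSeries.term_def₀ (by simp), idealSeries_apply, Rat.cast_sum, Finset.sum_mul]
  exact Finset.sum_congr rfl fun I hI ↦ by rw [(mem_idealsOfNorm.1 hI).1]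

theorem norm_term_idealSeries {f : Ideal R → ℚ} (hf : ∀ I, 0 ≤ f I) (s : ℂ) (n : ℕ) :
    ‖LSeries.term (fun n ↦ (idealSeries f n : ℂ)) s n‖ =
      ∑ I ∈ idealsOfNorm R n, ‖(f I : ℂ) * (Ideal.absNorm I : ℂ) ^ (-s)‖ := by
  have norm_cast_of_nonneg {q : ℚ} (hq : 0 ≤ q) : ‖(q : ℂ)‖ = q := by
    rw [Complex.norm_ratCast, abs_of_nonneg (Rat.cast_nonneg.2 hq)]
  rw [LSeries.term_def₀ (by simp), norm_mul, norm_cast_of_nonneg (idealSeries_nonneg hf n),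
    idealSeries_apply, Rat.cast_sum, Finset.sum_mul]
  refine Finset.sum_congr rfl fun I hI ↦ ?_
  rw [norm_mul, norm_cast_of_nonneg (hf I), (mem_idealsOfNorm.1 hI).1]

theorem hasSum_idealSeries {f : Ideal R → ℚ} (hf : ∀ I, 0 ≤ f I) {s : ℂ}
    (hs : LSeriesSummable (fun n ↦ (idealSeries f n : ℂ)) s) :
    HasSum (fun I : {I : Ideal R // Finite (R ⧸ I)} ↦
      (f I.1 : ℂ) * (Ideal.absNorm I.1 : ℂ) ^ (-s))
      (LSeries (fun n ↦ (idealSeries f n : ℂ)) s) := by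
  let F (I : Ideal R) : ℂ := (f I : ℂ) * (Ideal.absNorm I : ℂ) ^ (-s)
  have summable_sigma : Summable fun x : Σ n, idealsOfNorm R n ↦ F x.2 := by
    rw [← summable_norm_iff, summable_sigma_of_nonneg fun _ ↦ norm_nonneg _]
    refine ⟨fun n ↦ .of_finite, hs.norm.congr fun n ↦ ?_⟩
    rw [tsum_fintype, norm_term_idealSeries hf,
      Finset.sum_coe_sort (idealsOfNorm R n) fun I ↦ ‖F I‖]
  have hasSum_fiber (n : ℕ) : HasSum (fun I : idealsOfNorm R n ↦ F I)
      (LSeries.term (fun n ↦ (idealSeries f n : ℂ)) s n) := by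
    rw [term_idealSeries, ← Finset.sum_coe_sort (idealsOfNorm R n) F]
    exact hasSum_fintype _
  rw [← (sigmaIdealsOfNormEquiv R).hasSum_iff, LSeries,
    (summable_sigma.hasSum.sigma hasSum_fiber).tsum_eq]
  exact summable_sigma.hasSum

theorem cast_mul_eq_convolution (f g : ArithmeticFunction ℚ) :
    (fun n ↦ ((f * g) n : ℂ)) = LSeries.convolution (fun n ↦ (f n : ℂ)) (fun n ↦ (g n : ℂ)) := by
  rw [LSeries.convolution_def]
  ext n
  simp [ArithmeticFunction.mul_apply]

theorem le_mul_of_nonneg_of_apply_one {S : Type*} [Semiring S] [PartialOrder S] [IsOrderedRing S]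
    {f g : ArithmeticFunction S} (hf : ∀ n, 0 ≤ f n) (hg : ∀ n, 0 ≤ g n)
    (hg_one : g 1 = 1) (n : ℕ) : f n ≤ (f * g) n := by
  rcases eq_or_ne n 0 with rfl | hn
  · simp
  calc f n = f n * g 1 := by rw [hg_one, mul_one]
    _ ≤ ∑ x ∈ n.divisorsAntidiagonal, f x.1 * g x.2 :=
      Finset.single_le_sum (f := fun x : ℕ × ℕ ↦ f x.1 * g x.2)
        (fun x _ ↦ mul_nonneg (hf _) (hg _)) (show (n, 1) ∈ _ by simp [hn])
    _ = (f * g) n := ArithmeticFunction.mul_apply.symm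

theorem lseriesSummable_of_mul {f g : ArithmeticFunction ℚ} (hf : ∀ n, 0 ≤ f n)
    (hg : ∀ n, 0 ≤ g n) (hg_one : g 1 = 1) {s : ℂ}
    (hs : LSeriesSummable (fun n ↦ ((f * g) n : ℂ)) s) :
    LSeriesSummable (fun n ↦ (f n : ℂ)) s := by
  refine Summable.of_norm_bounded hs.norm fun n ↦ LSeries.norm_term_le s ?_
  rw [Complex.norm_ratCast, Complex.norm_ratCast]
  exact abs_le_abs_of_nonneg (Rat.cast_nonneg.2 (hf n))
    (Rat.cast_le.2 (le_mul_of_nonneg_of_apply_one hf hg hg_one n))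

theorem card_idealsOfNorm {n : ℕ} (hn : n ≠ 0) :
    Nat.card {I : Ideal R // Ideal.absNorm I = n} = (idealsOfNorm R n).card :=
  Nat.subtype_card _ fun I ↦ by simp [hn]

theorem sum_card_idealsOfNorm_le (s : Finset ℕ) {N : ℕ} (hs : ∀ n ∈ s, n ≤ N) :
    ∑ n ∈ s, (idealsOfNorm R n).card ≤ Nat.card {I : Ideal R // Ideal.absNorm I ≤ N} := by
  classical
  have finite_le := Ideal.finite_setOfPred_absNorm_le (S := R) N
  rw [← Finset.card_biUnion fun m _ n _ hmn ↦ Finset.disjoint_left.2 fun I hm hn ↦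
    hmn ((mem_idealsOfNorm.1 hm).1.symm.trans (mem_idealsOfNorm.1 hn).1),
    ← Set.ncard_coe_finset]
  refine Set.ncard_le_ncard (fun I hI ↦ ?_) finite_le
  obtain ⟨n, hn, hI⟩ := Finset.mem_biUnion.1 hI
  exact (mem_idealsOfNorm.1 hI).1.trans_le (hs n hn)

theorem shiftedZeta_apply (c : ℤ) (n : ℕ) :
    shiftedZeta R c n = (idealsOfNorm R n).card * (n : ℚ) ^ c := by
  rw [shiftedZeta, idealSeries_apply, ← nsmul_eq_mul]
  exact Finset.sum_eq_card_nsmul fun I hI ↦ by rw [(mem_idealsOfNorm.1 hI).1]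

theorem term_shiftedZeta (c : ℤ) (s : ℂ) (n : ℕ) :
    LSeries.term (fun n ↦ (shiftedZeta R c n : ℂ)) s n =
      LSeries.term (fun n ↦ ((idealsOfNorm R n).card : ℂ)) (s - c) n := by
  rcases eq_or_ne n 0 with rfl | hn
  · simp only [LSeries.term_zero]
  rw [LSeries.term_of_ne_zero hn, LSeries.term_of_ne_zero hn, shiftedZeta_apply,
    Complex.cpow_sub _ _ (Nat.cast_ne_zero.2 hn), Complex.cpow_intCast, div_div_eq_mul_div]
  push_cast
  rfl

end Convergence

section DedekindZeta

open NumberField Filter Topology Asymptotics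

variable (k : Type*) [Field k] [NumberField k]

theorem dedekindZetaFormal_eq (c : ℤ) : dedekindZetaFormal k c = shiftedZeta (𝓞 k) c := by
  ext n
  rcases eq_or_ne n 0 with rfl | hn
  · simp only [ArithmeticFunction.map_zero]
  · rw [shiftedZeta_apply, ← card_idealsOfNorm hn]
    exact if_neg hn

theorem lseriesSummable_card_idealsOfNorm {s : ℂ} (hs : 1 < s.re) :
    LSeriesSummable (fun n ↦ ((idealsOfNorm (𝓞 k) n).card : ℂ)) s := by
  have isBigO_card_le :
      (fun N : ℕ ↦ (Nat.card {I : Ideal (𝓞 k) // Ideal.absNorm I ≤ N} : ℝ))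
        =O[atTop] fun N ↦ (N : ℝ) ^ (1 : ℝ) := by
    refine isBigO_atTop_natCast_rpow_of_tendsto_div_rpow
      (((Ideal.tendsto_norm_le_div_atTop k).comp tendsto_natCast_atTop_atTop).congr fun N ↦ ?_)
    simp
  have isBigO_sum : (fun N : ℕ ↦ ∑ n ∈ Finset.Icc 1 N, ((idealsOfNorm (𝓞 k) n).card : ℝ))
      =O[atTop] fun N ↦ (N : ℝ) ^ (1 : ℝ) := by
    refine .trans (.of_norm_le fun N ↦ ?_) isBigO_card_le
    rw [Real.norm_of_nonneg (by positivity)]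
    exact_mod_cast sum_card_idealsOfNorm_le _ fun n hn ↦ (Finset.mem_Icc.1 hn).2
  simpa only [Complex.ofReal_natCast] using LSeriesSummable_of_sum_norm_bigO_and_nonneg isBigO_sum
    (fun _ ↦ Nat.cast_nonneg _) zero_le_one hs

theorem lseriesSummable_shiftedZeta {c : ℤ} {s : ℂ} (hs : 1 + c < s.re) :
    LSeriesSummable (fun n ↦ (shiftedZeta (𝓞 k) c n : ℂ)) s := by
  rw [LSeriesSummable, funext (term_shiftedZeta c s)]
  refine lseriesSummable_card_idealsOfNorm k ?_
  rw [Complex.sub_re, Complex.intCast_re]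
  linarith

theorem lseries_shiftedZeta (c : ℤ) (s : ℂ) :
    LSeries (fun n ↦ (shiftedZeta (𝓞 k) c n : ℂ)) s = dedekindZeta k (s - c) :=
  (tsum_congr (term_shiftedZeta c s)).trans <|
    LSeries_congr (fun hn ↦ by rw [card_idealsOfNorm hn]) _

theorem hasSum_dedekindZeta {s : ℂ} (hs : 1 < s.re) :
    HasSum (fun I : {I : Ideal (𝓞 k) // Finite (𝓞 k ⧸ I)} ↦ (Ideal.absNorm I.1 : ℂ) ^ (-s))
      (dedekindZeta k s) := by
  have h := hasSum_idealSeries (R := 𝓞 k) (f := fun I ↦ (Ideal.absNorm I : ℚ) ^ (0 : ℤ)) (s := s)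
    (fun I ↦ by positivity) (lseriesSummable_shiftedZeta k (by simpa using hs))
  rw [← shiftedZeta, lseries_shiftedZeta] at h
  simpa only [zpow_zero, Rat.cast_one, one_mul, Int.cast_zero, sub_zero] using h

/-- The completely multiplicative function `I ↦ N(I)^{-s}` on the ideals of `𝔬`. -/
noncomputable def absNormCPow {s : ℂ} (hs : s ≠ 0) : Ideal (𝓞 k) →*₀ ℂ where
  toFun I := (Ideal.absNorm I : ℂ) ^ (-s)
  map_zero' := by simp [Complex.zero_cpow (neg_ne_zero.2 hs)]
  map_one' := by simp
  map_mul' I J := by rw [map_mul, Nat.cast_mul, Complex.natCast_mul_natCast_cpow]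

theorem dedekindZeta_ne_zero {s : ℂ} (hs : 1 < s.re) : dedekindZeta k s ≠ 0 := by
  have hs0 : s ≠ 0 := Complex.ne_zero_of_re_pos (zero_lt_one.trans hs)
  have hasSum_absNormCPow : HasSum (absNormCPow k hs0) (dedekindZeta k s) := by
    refine (hasSum_subtype_iff_of_support_subset (s := {I : Ideal (𝓞 k) | Finite (𝓞 k ⧸ I)})
      fun I hI ↦ ?_).1 (hasSum_dedekindZeta k hs)
    exact finite_quotient_of_ne_bot fun hI0 ↦ hI (by rw [hI0]; exact map_zero (absNormCPow k hs0))
  rw [← hasSum_absNormCPow.tsum_eq]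
  exact tsum_monoidWithZeroHom_ne_zero _ hasSum_absNormCPow.summable.norm

end DedekindZeta

section ClassNumberZeta

universe u

open NumberField

variable (k : Type u) [Field k] [NumberField k] (d : ℕ)

theorem finite_gammaGroup_obj (I : Ideal (𝓞 k)) [Finite (𝓞 k ⧸ I)] :
    Finite ((gammaGroup k d).obj (CommAlgCat.of (𝓞 k) (𝓞 k ⧸ I))) :=
  Finite.of_equiv _ (gammaGroupEquiv (R := 𝓞 k) (𝓞 k ⧸ I) d).symm.toEquiv

theorem quotientClassNumber_gammaGroup (I : Ideal (𝓞 k)) [Finite (𝓞 k ⧸ I)] :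
    (quotientClassNumber (gammaGroup k d) I : ℚ) = reducedClassNumber (𝓞 k ⧸ I) d *
      (Ideal.absNorm I : ℚ) ^ ((d + 1).choose 2 : ℤ) := by
  rw [mul_comm, zpow_natCast, Ideal.absNorm_apply, Submodule.cardQuot_apply, ← classNumber_cRep,
    ← classNumber_congr (gammaGroupEquiv (R := 𝓞 k) (𝓞 k ⧸ I) d)]
  rfl

theorem ccZetaTerm_gammaGroup (s : ℂ) (I : {I : Ideal (𝓞 k) // Finite (𝓞 k ⧸ I)}) :
    ccZetaTerm (gammaGroup k d) s I =
      (reducedClassNumber (𝓞 k ⧸ I.1) d * (Ideal.absNorm I.1 : ℚ) ^ ((d + 1).choose 2 : ℤ) : ℚ) *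
        (Ideal.absNorm I.1 : ℂ) ^ (-s) := by
  have := I.2
  rw [← quotientClassNumber_gammaGroup, Rat.cast_natCast]
  rfl

theorem ccZetaFormal_gammaGroup :
    ccZetaFormal (gammaGroup k d) = idealSeries fun I : Ideal (𝓞 k) ↦
      reducedClassNumber (𝓞 k ⧸ I) d * (Ideal.absNorm I : ℚ) ^ ((d + 1).choose 2 : ℤ) := by
  ext n
  rcases eq_or_ne n 0 with rfl | hn
  · simp only [ArithmeticFunction.map_zero]
  have card_eq_iff (I : Ideal (𝓞 k)) : Nat.card (𝓞 k ⧸ I) = n ↔ I ∈ idealsOfNorm (𝓞 k) n := by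
    simp [hn, Ideal.absNorm_apply, Submodule.cardQuot_apply]
  calc ccZetaFormal (gammaGroup k d) n
      = ∑ᶠ (I : Ideal (𝓞 k)) (_ : Nat.card (𝓞 k ⧸ I) = n),
          (quotientClassNumber (gammaGroup k d) I : ℚ) :=
        (if_neg hn).trans (finsum_subtype_eq_finsum_cond (f := fun I : Ideal (𝓞 k) ↦
          (quotientClassNumber (gammaGroup k d) I : ℚ)) fun I ↦ Nat.card (𝓞 k ⧸ I) = n)
    _ = ∑ I ∈ idealsOfNorm (𝓞 k) n, (quotientClassNumber (gammaGroup k d) I : ℚ) := by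
        simp only [card_eq_iff, finsum_mem_finset_eq_sum]
    _ = _ := Finset.sum_congr rfl fun I hI ↦ by
        obtain ⟨norm_eq, -⟩ := mem_idealsOfNorm.1 hI
        have : Finite (𝓞 k ⧸ I) := (Ideal.absNorm_ne_zero_iff I).1 (norm_eq.trans_ne hn)
        exact quotientClassNumber_gammaGroup k d I

theorem ccZetaFormal_mul_shiftedZeta :
    ccZetaFormal (gammaGroup k d) * shiftedZeta (𝓞 k) ((d + 1).choose 2 - 1) =
      shiftedZeta (𝓞 k) ((d + 1).choose 2 + d) * shiftedZeta (𝓞 k) ((d + 1).choose 2 + d - 1) := by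
  rw [ccZetaFormal_gammaGroup]
  exact reducedClassNumber_mul_shiftedZeta d _

variable {d} {s : ℂ} (hs : ((d + 1).choose 2 : ℝ) + d + 1 < s.re)

include hs

theorem lseriesSummable_ccZetaFormal :
    LSeriesSummable (fun n ↦ (ccZetaFormal (gammaGroup k d) n : ℂ)) s := by
  have ccZetaFormal_nonneg : ∀ n, 0 ≤ ccZetaFormal (gammaGroup k d) n := by
    rw [ccZetaFormal_gammaGroup]
    exact idealSeries_nonneg fun I ↦ mul_nonneg (reducedClassNumber_nonneg d) (by positivity)
  have hs₁ := lseriesSummable_shiftedZeta k (c := (d + 1).choose 2 + d) (s := s)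
    (by push_cast; linarith)
  have hs₂ := lseriesSummable_shiftedZeta k (c := (d + 1).choose 2 + d - 1) (s := s)
    (by push_cast; linarith)
  have summable_mul := hs₁.convolution hs₂
  rw [← cast_mul_eq_convolution, ← ccZetaFormal_mul_shiftedZeta] at summable_mul
  exact lseriesSummable_of_mul ccZetaFormal_nonneg (idealSeries_nonneg fun I ↦ by positivity)
    (shiftedZeta_apply_one _) summable_mul

theorem hasSum_ccZetaTerm :
    HasSum (ccZetaTerm (gammaGroup k d) s)
      (LSeries (fun n ↦ (ccZetaFormal (gammaGroup k d) n : ℂ)) s) := by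
  have summable := lseriesSummable_ccZetaFormal k hs
  rw [ccZetaFormal_gammaGroup] at summable ⊢
  have hasSum := hasSum_idealSeries
    (fun I ↦ mul_nonneg (reducedClassNumber_nonneg d) (by positivity)) summable
  rwa [← funext (ccZetaTerm_gammaGroup k d s)] at hasSum

theorem lseries_ccZetaFormal_mul_dedekindZeta :
    LSeries (fun n ↦ (ccZetaFormal (gammaGroup k d) n : ℂ)) s *
        dedekindZeta k (s - ((d + 1).choose 2 : ℂ) + 1) =
      dedekindZeta k (s - ((d + 1).choose 2 : ℂ) - d) *
        dedekindZeta k (s - ((d + 1).choose 2 : ℂ) - d + 1) := by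
  have hs₁ := lseriesSummable_shiftedZeta k (c := (d + 1).choose 2 + d) (s := s)
    (by push_cast; linarith)
  have hs₂ := lseriesSummable_shiftedZeta k (c := (d + 1).choose 2 + d - 1) (s := s)
    (by push_cast; linarith)
  have hs₃ := lseriesSummable_shiftedZeta k (c := (d + 1).choose 2 - 1) (s := s)
    (by push_cast; linarith [d.cast_nonneg (α := ℝ)])
  have h := LSeries_convolution' (lseriesSummable_ccZetaFormal k hs) hs₃
  rw [← cast_mul_eq_convolution, ccZetaFormal_mul_shiftedZeta, cast_mul_eq_convolution,
    LSeries_convolution' hs₁ hs₂] at h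
  simp only [lseries_shiftedZeta] at h
  push_cast at h
  simpa only [sub_sub_eq_add_sub, sub_add, ← sub_sub] using h.symm

end ClassNumberZeta

end AskZeta

/-- The conjugacy class zeta function of the group functor attached to `γ_d` over `𝔬` equals
`ζ_k(s - C - d) ζ_k(s - C - d + 1) / ζ_k(s - C + 1)` with `C = (d + 1).choose 2`: as an identity of
formal Dirichlet series, the denominator being invertible, and as an identity of complex numbers
for all `s` in the half-plane `Re s > C + d + 1`, where the series converges absolutely. -/
theorem proposition6p11 (k : Type*) [Field k] [NumberField k] (d : ℕ) :
    (∀ I : Ideal (NumberField.RingOfIntegers k), Finite (NumberField.RingOfIntegers k ⧸ I) →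
      Finite ((AskZeta.gammaGroup k d).obj
        (CommAlgCat.of (NumberField.RingOfIntegers k) (NumberField.RingOfIntegers k ⧸ I)))) ∧
    (IsUnit (AskZeta.dedekindZetaFormal k (((d + 1).choose 2 : ℤ) - 1)) ∧
      AskZeta.ccZetaFormal (AskZeta.gammaGroup k d) *
          AskZeta.dedekindZetaFormal k (((d + 1).choose 2 : ℤ) - 1) =
        AskZeta.dedekindZetaFormal k (((d + 1).choose 2 : ℤ) + d) *
          AskZeta.dedekindZetaFormal k (((d + 1).choose 2 : ℤ) + d - 1)) ∧
    ∀ s : ℂ, ((d + 1).choose 2 : ℝ) + d + 1 < s.re →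
      NumberField.dedekindZeta k (s - ((d + 1).choose 2 : ℂ) + 1) ≠ 0 ∧
      HasSum (AskZeta.ccZetaTerm (AskZeta.gammaGroup k d) s)
        (NumberField.dedekindZeta k (s - ((d + 1).choose 2 : ℂ) - d) *
            NumberField.dedekindZeta k (s - ((d + 1).choose 2 : ℂ) - d + 1) /
          NumberField.dedekindZeta k (s - ((d + 1).choose 2 : ℂ) + 1)) := by
  refine ⟨fun I _ ↦ AskZeta.finite_gammaGroup_obj k d I, ⟨?_, ?_⟩, fun s hs ↦ ?_⟩
  · rw [AskZeta.dedekindZetaFormal_eq]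
    exact AskZeta.isUnit_shiftedZeta _
  · simpa only [AskZeta.dedekindZetaFormal_eq] using AskZeta.ccZetaFormal_mul_shiftedZeta k d
  · have denominator_ne_zero : NumberField.dedekindZeta k (s - ((d + 1).choose 2 : ℂ) + 1) ≠ 0 :=
      AskZeta.dedekindZeta_ne_zero k (by simp; linarith [d.cast_nonneg (α := ℝ)])
    refine ⟨denominator_ne_zero, ?_⟩
    rw [← AskZeta.lseries_ccZetaFormal_mul_dedekindZeta k hs,
      mul_div_cancel_right₀ _ denominator_ne_zero]
    exact AskZeta.hasSum_ccZetaTerm k hs
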